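/- Let $q$ be a prime power with $q\equiv 1\pmod 3$, let $k=\overline{\mathbb F}_{q^2}$ be an algebraic closure of $\mathbb F_{q^2}$, and let $\zeta_3\in k$ be a primitive cube root of unity. Let $\overline H_1=k(u,v)$ with $v^{q+1}=u^q+u$ be the Hermitian function field, and let $\overline Y_3=k(x,y)\subseteq \overline H_1$ be its subfield generated by $x=uv$ and $y=v^3$ (so that $x^q+xy^{(q-1)/3}=y^{(2q+1)/3}$). For a place $P$ of $\overline Y_3$ over $k$ let $\alpha(P)\in k\cup\{\infty\}$ be $b^{(q+2)/3}/a$ if $x(P)=a\in k\setminus\{0\}$ and $y(P)=b\in k$; let $\alpha(P)=1$ if $P$ lies below the zero of $u$, $\alpha(P)=0$ if $P$ lies below another zero of $v$, and $\alpha(P)=\infty$ if $P$ lies below the pole of $u$. Put $$\mathcal P_i(s)=\frac{(s+\zeta_3)^{3i}-(s+\zeta_3^2)^{3i}}{3(\zeta_3-\zeta_3^2)s(s-1)},\qquad \mathcal Q_i(s)=\frac{\frac{1-\zeta_3}{3}(s+\zeta_3)^{3i-1}+\frac{1-\zeta_3^2}{3}(s+\zeta_3^2)^{3i-1}}{s-1}.$$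 For a place $P$ with $\alpha=\alpha(P)\in k\setminus\{0,1,-\zeta_3,-\zeta_3^2\}$, the $\mathcal P$-order of $P$ is the smallest positive integer $i$ with $\mathcal P_{i+1}(\alpha)=0$, and the $\mathcal Q$-order of $P$ is the smallest positive integer $K$ with $\mathcal Q_{K+1}(1-\alpha)=0$ if such a $K$ exists, and $\infty$ otherwise. (For other places these orders are not defined.) Let $i$ be a positive integer with $\gcd(i+1,q)=1$, and let $\varphi$ be the Euler totient function. Then there are exactly $(q^2-1)\varphi(i+1)$ places $P$ of $\overline Y_3$ with $\mathcal P$-order $i$. If $i+1\equiv 0\pmod 3$, all of these have infinite $\mathcal Q$-order. If $i+1\not\equiv 0\pmod 3$, precisely $2(q^2-1)\varphi(i+1)/3$ of these places have infinite $\mathcal Q$-order, while the remaining $(q^2-1)\varphi(i+1)/3$ have a finite $\mathcal Q$-order $K$, namely $K=2i/3$ if $i+1\equiv 1\pmod 3$, and $K=(i-1)/3$ if $i+1\equiv 2\pmod 3$ and $i>1$; if $i=1$, then $K=2$. -/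

import Mathlib

open Polynomial

namespace MaxCurve

/-! ### Places of a field extension -/

/-- A place of `L` over `k`, given by its valuation ring: a valuation ring of `L` that contains
the constants `k` and is not all of `L`. -/
@[ext]
structure Place (k L : Type*) [Field k] [Field L] [Algebra k L] where
  ring : ValuationSubring L
  algebraMap_mem : ∀ c : k, algebraMap k L c ∈ ring
  ne_top : ring ≠ ⊤

/-- `f(P) = a`: the function `f` is regular at `P` and its residue class is that of `a`, i.e.
`f - a` lies in the maximal ideal of the valuation ring. -/
def Place.HasValue {k L : Type*} [Field k] [Field L] [Algebra k L]
    (P : Place k L) (f : L) (a : k) : Prop :=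
  P.ring.valuation (f - algebraMap k L a) < 1

/-- The place `Q` of the extension field `M` lies above the place `P` of `L`. -/
def Place.LiesAbove {k L M : Type*} [Field k] [Field L] [Field M] [Algebra k L] [Algebra k M]
    [Algebra L M] (Q : Place k M) (P : Place k L) : Prop :=
  Q.ring.comap (algebraMap L M) = P.ring

/-! ### The Hermitian function field and its subfield of index three -/

/-- The polynomial `V ^ (q + 1) - (U ^ q + U)`, as a polynomial in `V` over `k[U]`. -/
noncomputable def hermitianPoly (q : ℕ) (k : Type*) [Field k] : k[X][X] :=
  X ^ (q + 1) - C (X ^ q + X)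

theorem hermitianPoly_irreducible (q : ℕ) (hq : 1 < q) (k : Type*) [Field k] :
    Irreducible (hermitianPoly q k) := by
  have hdeg : (hermitianPoly q k).natDegree = q + 1 :=
    natDegree_X_pow_sub_C
  have hmonic : (hermitianPoly q k).Monic := monic_X_pow_sub_C _ (by omega)
  have hprime : (Ideal.span {(X : k[X])}).IsPrime :=
    (Ideal.span_singleton_prime X_ne_zero).2 prime_X
  have heis : (hermitianPoly q k).IsEisensteinAt (Ideal.span {(X : k[X])}) := by
    refine ⟨?_, ?_, ?_⟩
    · rw [hmonic.leadingCoeff]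
      exact fun h => hprime.ne_top ((Ideal.eq_top_iff_one _).2 h)
    · intro n hn
      rw [hdeg] at hn
      rw [hermitianPoly, coeff_sub, coeff_X_pow, if_neg (by omega), coeff_C, zero_sub]
      split_ifs with h
      · rw [Ideal.neg_mem_iff, Ideal.mem_span_singleton, X_dvd_iff]
        simp [show ¬ 0 = q by omega]
      · simp
    · rw [hermitianPoly, coeff_sub, coeff_X_pow, if_neg (by omega), coeff_C_zero, zero_sub,
        Ideal.neg_mem_iff, Ideal.span_singleton_pow, Ideal.mem_span_singleton, X_pow_dvd_iff]
      intro h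
      have h1 := h 1 (by norm_num)
      simp [coeff_X_pow, show ¬ 1 = q by omega] at h1
  exact heis.irreducible hprime hmonic.isPrimitive (by omega)

/-- The affine coordinate ring `k[u, v]` with `v ^ (q + 1) = u ^ q + u`. -/
abbrev HermitianRing (q : ℕ) (k : Type*) [Field k] : Type _ := AdjoinRoot (hermitianPoly q k)

instance (q : ℕ) [hq : Fact (IsPrimePow q)] (k : Type*) [Field k] :
    IsDomain (HermitianRing q k) :=
  AdjoinRoot.isDomain_of_prime (hermitianPoly_irreducible q hq.out.one_lt k).prime

/-- The Hermitian function field `k(u, v)` with `v ^ (q + 1) = u ^ q + u`. -/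
abbrev HermitianField (q : ℕ) [Fact (IsPrimePow q)] (k : Type*) [Field k] : Type _ :=
  FractionRing (HermitianRing q k)

section

variable (q : ℕ) [Fact (IsPrimePow q)] (k : Type*) [Field k]

/-- The function `u` of the Hermitian function field. -/
noncomputable def uFun : HermitianField q k :=
  algebraMap (HermitianRing q k) (HermitianField q k) (AdjoinRoot.of (hermitianPoly q k) X)

/-- The function `v` of the Hermitian function field. -/
noncomputable def vFun : HermitianField q k :=
  algebraMap (HermitianRing q k) (HermitianField q k) (AdjoinRoot.root (hermitianPoly q k))

theorem vFun_pow : vFun q k ^ (q + 1) = uFun q k ^ q + uFun q k := by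
  have h : AdjoinRoot.root (hermitianPoly q k) ^ (q + 1) =
      AdjoinRoot.of (hermitianPoly q k) (X ^ q + X) := by
    have h0 : AdjoinRoot.mk (hermitianPoly q k) (X ^ (q + 1) - C (X ^ q + X)) = 0 :=
      AdjoinRoot.mk_self
    rwa [map_sub, map_pow, AdjoinRoot.mk_X, AdjoinRoot.mk_C, sub_eq_zero] at h0
  rw [vFun, uFun, ← map_pow, h, map_add, map_pow, map_add, map_pow]

/-- The function field `k(x, y)`, `x = u v`, `y = v ^ 3`, inside the Hermitian function field.
For `k` an algebraic closure of the field with `q ^ 2` elements this is the constant field extension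
to `k` of the subfield generated by `x` and `y` over that finite field. -/
noncomputable abbrev Y3 : IntermediateField k (HermitianField q k) :=
  IntermediateField.adjoin k {uFun q k * vFun q k, vFun q k ^ 3}

/-- The function `x = u v`. -/
noncomputable def xFun : Y3 q k :=
  ⟨uFun q k * vFun q k, IntermediateField.subset_adjoin _ _ (by simp)⟩

/-- The function `y = v ^ 3`. -/
noncomputable def yFun : Y3 q k :=
  ⟨vFun q k ^ 3, IntermediateField.subset_adjoin _ _ (by simp)⟩

variable {q k}

/-- `P` is the place `P_{(0,0)}` lying below the zero of `u`. -/
def IsOriginPlace (P : Place k (Y3 q k)) : Prop :=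
  ∃ Q : Place k (HermitianField q k), Q.LiesAbove P ∧ Q.HasValue (uFun q k) 0

/-- `P` is one of the places lying below the zeros of `v` other than the zero of `u`. -/
def IsZeroPlace (P : Place k (Y3 q k)) : Prop :=
  ∃ Q : Place k (HermitianField q k),
    Q.LiesAbove P ∧ Q.HasValue (vFun q k) 0 ∧ ¬ Q.HasValue (uFun q k) 0

open Classical in
/-- `α(P)`, an element of `k ∪ {∞}`: it is `b ^ ((q + 2) / 3) / a` if `x(P) = a ≠ 0` and
`y(P) = b`, it is `0` at the zeros of `v` different from that of `u`, it is `1` at the zero of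
`u`, and it is `∞` at the only place that is left, namely the common pole of `x` and `y`. -/
noncomputable def alphaAt (P : Place k (Y3 q k)) : OnePoint k :=
  if h : ∃ c : k × k, c.1 ≠ 0 ∧ P.HasValue (xFun q k) c.1 ∧ P.HasValue (yFun q k) c.2 then
    ((h.choose.2 ^ ((q + 2) / 3) / h.choose.1 : k) : OnePoint k)
  else if IsZeroPlace P then ((0 : k) : OnePoint k)
  else if IsOriginPlace P then ((1 : k) : OnePoint k)
  else OnePoint.infty

end

/-! ### The two orders -/

section

variable {k : Type*} [Field k]

/-- The rational function `𝒫_i(s)`, where `ζ` is a primitive cube root of unity, as an expression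
in `s`. It is used below only where its denominator does not vanish. -/
def calP (ζ : k) (i : ℤ) (s : k) : k :=
  ((s + ζ) ^ (3 * i) - (s + ζ ^ 2) ^ (3 * i)) / (3 * (ζ - ζ ^ 2) * s * (s - 1))

/-- The rational function `𝒬_i(s)`, where `ζ` is a primitive cube root of unity, as an expression
in `s`. It is used below only where its denominator does not vanish. -/
def calQ (ζ : k) (i : ℤ) (s : k) : k :=
  ((1 - ζ) / 3 * (s + ζ) ^ (3 * i - 1) + (1 - ζ ^ 2) / 3 * (s + ζ ^ 2) ^ (3 * i - 1)) / (s - 1)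

/-- The values of `α` for which the two orders are defined. -/
def Admissible (ζ α : k) : Prop := α ≠ 0 ∧ α ≠ 1 ∧ α ≠ -ζ ∧ α ≠ -ζ ^ 2

/-- The smallest positive integer `i` with `𝒫_{i+1}(α) = 0` (and `∞` if there is none). -/
noncomputable def pOrder (ζ α : k) : ℕ∞ :=
  sInf ((↑) '' {i : ℕ | 0 < i ∧ calP ζ ((i : ℤ) + 1) α = 0})

/-- The smallest positive integer `K` with `𝒬_{K+1}(1 - α) = 0`, and `∞` if there is none. -/
noncomputable def qOrder (ζ α : k) : ℕ∞ :=
  sInf ((↑) '' {K : ℕ | 0 < K ∧ calQ ζ ((K : ℤ) + 1) (1 - α) = 0})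

variable {q : ℕ} [Fact (IsPrimePow q)]

/-- The `𝒫`-order of the place `P` is defined and equal to `i`. -/
def HasPOrder (ζ : k) (P : Place k (Y3 q k)) (i : ℕ∞) : Prop :=
  ∃ α : k, alphaAt P = (α : OnePoint k) ∧ Admissible ζ α ∧ pOrder ζ α = i

/-- The `𝒬`-order of the place `P` is defined and equal to `K`, which may be `∞`. -/
def HasQOrder (ζ : k) (P : Place k (Y3 q k)) (K : ℕ∞) : Prop :=
  ∃ α : k, alphaAt P = (α : OnePoint k) ∧ Admissible ζ α ∧ qOrder ζ α = K

end

end MaxCurve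

/-! Both orders depend only on `β = (α + ζ) / (α + ζ ^ 2)`, a Möbius coordinate sending `α = 0, 1,
-ζ, -ζ ^ 2` to `ζ ^ 2, ζ, 0, ∞` and `α = ∞` to `1`; so admissible `α` correspond to `β ≠ 0` with `β
^ 3 ≠ 1`. Then `𝒫_{j+1}(α) = 0` means `β ^ (3 (j + 1)) = 1`, and `𝒬_{K+1}(1 - α) = 0` means `β ^ (3
K + 2) = ζ`. So `𝒫`-order `i` says that `β ^ 3` has order `i + 1`, which leaves `3 φ(i + 1)` values
of `β`.

The `𝒬`-condition is `(ζ β) ^ (3 K + 2) = 1`. It forces the order of `ζ β` to be prime to 3, hence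
equal to that of `(ζ β) ^ 3 = β ^ 3`. For `3 ∣ i + 1` this is impossible; otherwise it selects the
`φ(i + 1)` values with `ζ β` a primitive `(i + 1)`-th root of unity, and `K` is the least positive
integer with `i + 1 ∣ 3 K + 2`.

Each `α ≠ 0, 1` is attained at exactly `(q ^ 2 - 1) / 3` places (`encard_places_alphaAt_mem`):
eliminating `x` turns the curve into `b ^ ((q ^ 2 - 1) / 3) = α ^ (q - 1) * (α - 1)`, which is
separable in `b`. This needs places with `y ≠ 0` to be the same as points `(a, b)` of the plane
model: `Place.eq_of_hasValue` (nonsingularity) and `exists_place_of_point` (lifting to the Hermitian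
curve). -/

namespace MaxCurve

/-! ### Arithmetic of values at a place -/

section Value

variable {k L : Type*} [Field k] [Field L] [Algebra k L] (P : Place k L)

theorem Place.valuation_algebraMap {c : k} (hc : c ≠ 0) :
    P.ring.valuation (algebraMap k L c) = 1 := by
  apply le_antisymm ((P.ring.valuation_le_one_iff _).2 (P.algebraMap_mem c))
  have h := (P.ring.valuation_le_one_iff _).2 (P.algebraMap_mem c⁻¹)
  have hm : P.ring.valuation (algebraMap k L c) * P.ring.valuation (algebraMap k L c⁻¹) = 1 := by
    rw [← map_mul, ← map_mul, mul_inv_cancel₀ hc, map_one, map_one]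
  rw [← hm]
  exact mul_le_of_le_one_right' h

variable {P}

theorem Place.HasValue.unique {f : L} {a b : k} (ha : P.HasValue f a) (hb : P.HasValue f b) :
    a = b := by
  by_contra h
  have h1 := P.valuation_algebraMap (sub_ne_zero.2 h)
  have h2 : algebraMap k L (a - b) = (f - algebraMap k L b) - (f - algebraMap k L a) := by
    rw [map_sub]; ring
  rw [h2] at h1
  exact absurd h1 (P.ring.valuation.map_sub_lt hb ha).ne

theorem Place.HasValue.mem {f : L} {a : k} (ha : P.HasValue f a) : f ∈ P.ring := by
  have h1 := (P.ring.valuation_le_one_iff _).1 (le_of_lt ha)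
  simpa using P.ring.add_mem _ _ h1 (P.algebraMap_mem a)

theorem Place.hasValue_algebraMap (c : k) : P.HasValue (algebraMap k L c) c := by
  simp [Place.HasValue]

theorem Place.HasValue.add {f g : L} {a b : k} (hf : P.HasValue f a) (hg : P.HasValue g b) :
    P.HasValue (f + g) (a + b) := by
  have h : f + g - algebraMap k L (a + b) = (f - algebraMap k L a) + (g - algebraMap k L b) := by
    rw [map_add]; ring
  rw [Place.HasValue, h]
  exact P.ring.valuation.map_add_lt hf hg

theorem Place.valuation_mul_lt_one {f g : L} (hf : P.ring.valuation f < 1) (hg : g ∈ P.ring) :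
    P.ring.valuation (f * g) < 1 := by
  rw [map_mul]
  exact (mul_le_of_le_one_right' ((P.ring.valuation_le_one_iff _).2 hg)).trans_lt hf

theorem Place.HasValue.mul {f g : L} {a b : k} (hf : P.HasValue f a) (hg : P.HasValue g b) :
    P.HasValue (f * g) (a * b) := by
  have h : f * g - algebraMap k L (a * b) =
      (f - algebraMap k L a) * g + algebraMap k L a * (g - algebraMap k L b) := by
    rw [map_mul]; ring
  rw [Place.HasValue, h]
  apply P.ring.valuation.map_add_lt
  · exact valuation_mul_lt_one hf hg.mem
  · rw [mul_comm]
    exact valuation_mul_lt_one hg (P.algebraMap_mem a)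

theorem Place.HasValue.pow {f : L} {a : k} (hf : P.HasValue f a) (n : ℕ) :
    P.HasValue (f ^ n) (a ^ n) := by
  induction n with
  | zero => simpa using P.hasValue_algebraMap (1 : k)
  | succ n ih => rw [pow_succ, pow_succ]; exact ih.mul hf

theorem Place.hasValue_zero_iff {f : L} : P.HasValue f (0 : k) ↔ P.ring.valuation f < 1 := by
  simp [Place.HasValue]

theorem Place.HasValue.valuation_eq_one {f : L} {a : k} (hf : P.HasValue f a) (ha : a ≠ 0) :
    P.ring.valuation f = 1 := by
  apply le_antisymm ((P.ring.valuation_le_one_iff _).2 hf.mem)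
  by_contra! h
  exact ha (hf.unique (Place.hasValue_zero_iff.2 h))

end Value

/-! ### At most one place over a nonsingular point -/

section Uniqueness

open IsLocalRing

variable {k L : Type*} [Field k] [Field L] [Algebra k L]

/-- A place is determined by the values of two generators at a nonsingular point. -/
theorem Place.eq_of_hasValue {x y : L} (hxy : IntermediateField.adjoin k {x, y} = ⊤)
    {P₁ P₂ : Place k L} {a b : k} (hx₁ : P₁.HasValue x a) (hy₁ : P₁.HasValue y b)
    (hx₂ : P₂.HasValue x a) (hy₂ : P₂.HasValue y b) {g w : L}
    (hg : g ∈ Algebra.adjoin k {x, y}) (hw : w ∈ Algebra.adjoin k {x, y})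
    (h : (x - algebraMap k L a) * g = (y - algebraMap k L b) * w)
    (hg₁ : P₁.ring.valuation g = 1) : P₁ = P₂ := by
  set B := Algebra.adjoin k {x, y} with hB
  set A : Subring L := B.toSubring with hA
  have hxB : x ∈ B := Algebra.subset_adjoin (by simp)
  have hyB : y ∈ B := Algebra.subset_adjoin (by simp)
  have hcA (c : k) : algebraMap k L c ∈ A := B.algebraMap_mem c
  let X : A := ⟨x - algebraMap k L a, sub_mem hxB (hcA a)⟩
  let T : A := ⟨y - algebraMap k L b, sub_mem hyB (hcA b)⟩
  -- Both places evaluate `k[x, y]` at `(a, b)`, so they have the same centre `p`, the ideal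
  -- generated by `x - a` and `y - b`.
  have hval : ∀ f (hf : f ∈ B), ∃ c : k, P₁.HasValue f c ∧ P₂.HasValue f c ∧
      (⟨f, hf⟩ - ⟨algebraMap k L c, hcA c⟩ : A) ∈ Ideal.span {X, T} := by
    intro f hf
    induction hf using Algebra.adjoin_induction with
    | mem f hf =>
      rcases hf with rfl | rfl
      · exact ⟨a, hx₁, hx₂, Ideal.subset_span (Or.inl rfl)⟩
      · exact ⟨b, hy₁, hy₂, Ideal.subset_span (Or.inr rfl)⟩
    | algebraMap c => exact ⟨c, hasValue_algebraMap c, hasValue_algebraMap c, by simp⟩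
    | add f₁ f₂ h₁ h₂ ih₁ ih₂ =>
      obtain ⟨c₁, u₁, v₁, w₁⟩ := ih₁
      obtain ⟨c₂, u₂, v₂, w₂⟩ := ih₂
      refine ⟨c₁ + c₂, u₁.add u₂, v₁.add v₂, ?_⟩
      convert! add_mem w₁ w₂ using 1
      ext; simp; ring
    | mul f₁ f₂ h₁ h₂ ih₁ ih₂ =>
      obtain ⟨c₁, u₁, v₁, w₁⟩ := ih₁
      obtain ⟨c₂, u₂, v₂, w₂⟩ := ih₂
      refine ⟨c₁ * c₂, u₁.mul u₂, v₁.mul v₂, ?_⟩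
      convert! add_mem (Ideal.mul_mem_right (⟨f₂, h₂⟩ : A) _ w₁)
        (Ideal.mul_mem_left _ (⟨algebraMap k L c₁, hcA c₁⟩ : A) w₂) using 1
      ext; simp; ring
  have hle : A ≤ P₁.ring.toSubring := fun f hf => (hval f hf).choose_spec.1.mem
  let φ : A →+* P₁.ring := Subring.inclusion hle
  let p : Ideal A := (maximalIdeal P₁.ring).comap φ
  have hp₁ (f : A) : f ∈ p ↔ P₁.ring.valuation (f : L) < 1 :=
    P₁.ring.valuation_lt_one_iff (φ f)
  have hp₂ (f : A) : f ∈ p ↔ P₂.ring.valuation (f : L) < 1 := by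
    rw [hp₁]
    obtain ⟨c, h₁, h₂, -⟩ := hval f.1 f.2
    constructor <;> intro hf
    · rwa [← hasValue_zero_iff, ← h₁.unique (hasValue_zero_iff.2 hf)]
    · rwa [← hasValue_zero_iff, ← h₂.unique (hasValue_zero_iff.2 hf)]
  have hpspan : p = Ideal.span {X, T} := by
    apply le_antisymm
    · intro f hf
      obtain ⟨c, h₁, -, h₃⟩ := hval f.1 f.2
      have hc : c = 0 := h₁.unique (hasValue_zero_iff.2 ((hp₁ f).1 hf))
      subst hc
      convert! h₃ using 1
      ext; simp
    · rw [Ideal.span_le]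
      rintro _ (rfl | rfl)
      · exact (hp₁ _).2 hx₁
      · exact (hp₁ _).2 hy₁
  have : p.IsPrime := inferInstanceAs ((maximalIdeal P₁.ring).comap φ).IsPrime
  let R := LocalSubring.ofPrime A p
  have : IsNoetherianRing A :=
    isNoetherianRing_of_fg (S := B) ((Subalgebra.fg_def).2 ⟨{x, y}, by simp, rfl⟩)
  have : IsNoetherianRing R.toSubring :=
    IsLocalization.isNoetherianRing p.primeCompl R.toSubring inferInstance
  let t : R.toSubring := algebraMap A R.toSubring T
  -- As `g` is a unit in the localization, the relation `h` makes `x - a` a multiple of `y - b`. A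
  -- Noetherian local domain with principal maximal ideal is a valuation ring.
  have hmax : maximalIdeal R.toSubring = Ideal.span {t} := by
    refine (IsLocalization.AtPrime.map_eq_maximalIdeal p R.toSubring).symm.trans
      ((congrArg (Ideal.map _) hpspan).trans ?_)
    rw [Ideal.map_span, Set.image_pair]
    apply le_antisymm
    · rw [Ideal.span_le]
      rintro _ (rfl | rfl)
      · have hu : IsUnit (algebraMap A R.toSubring ⟨g, hg⟩) :=
          IsLocalization.map_units R.toSubring
            (⟨⟨g, hg⟩, fun hgp => ((hp₁ _).1 hgp).ne hg₁⟩ : p.primeCompl)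
        refine (Ideal.mul_unit_mem_iff_mem _ hu).1 ?_
        rw [← map_mul, show X * ⟨g, hg⟩ = T * ⟨w, hw⟩ from Subtype.ext h, map_mul]
        exact Ideal.mul_mem_right _ _ (Ideal.mem_span_singleton_self _)
      · exact Ideal.mem_span_singleton_self _
    · exact Ideal.span_mono (by simp [t])
  have : ValuationRing R.toSubring :=
    ((tfae_of_isNoetherianRing_of_isLocalRing_of_isDomain R.toSubring).out 4 1 :
      (maximalIdeal R.toSubring).IsPrincipal ↔ ValuationRing R.toSubring).1 ⟨t, hmax⟩
  have : IsFractionRing R.toSubring L := by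
    refine .of_field _ _ fun z => ?_
    have hz : z ∈ IntermediateField.adjoin k {x, y} := hxy ▸ IntermediateField.mem_top
    obtain ⟨r, hr, s, hs, rfl⟩ := IntermediateField.mem_adjoin_iff_div.1 hz
    exact ⟨⟨r, LocalSubring.le_ofPrime A p hr⟩, ⟨s, LocalSubring.le_ofPrime A p hs⟩, rfl⟩
  have hnu (r : R.toSubring) (hr : ¬ IsUnit r) : ∃ d : R.toSubring, (r : L) = (T : L) * d := by
    have hr1 : r ∈ maximalIdeal R.toSubring := (mem_maximalIdeal _).2 hr
    rw [hmax, Ideal.mem_span_singleton] at hr1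
    obtain ⟨d, hd⟩ := hr1
    exact ⟨d, congrArg Subtype.val hd⟩
  have hR (z : L) : z ∈ R.toSubring ∨ z⁻¹ ∈ R.toSubring := by
    rcases ValuationRing.isInteger_or_isInteger R.toSubring z with ⟨r, hr⟩ | ⟨r, hr⟩
    · exact Or.inl (hr ▸ r.2)
    · exact Or.inr (hr ▸ r.2)
  let V : ValuationSubring L := ⟨R.toSubring, hR⟩
  -- The ring of each place dominates `V`, and valuation rings are maximal for domination.
  have key (P : Place k L) (hP : ∀ f : A, f ∈ p ↔ P.ring.valuation (f : L) < 1)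
      (hPA : A ≤ P.ring.toSubring) : V = P.ring := by
    have hsub : R.toSubring ≤ P.ring.toSubring := by
      intro r hr
      obtain ⟨⟨f, s⟩, hfs⟩ := IsLocalization.surj p.primeCompl (⟨r, hr⟩ : R.toSubring)
      have hfs' : r * (s : A) = (f : L) := congrArg Subtype.val hfs
      have hs : P.ring.valuation ((s : A) : L) = 1 :=
        le_antisymm ((P.ring.valuation_le_one_iff _).2 (hPA s.1.2))
          (not_lt.1 fun hs => s.2 ((hP s).2 hs))
      refine (P.ring.valuation_le_one_iff r).1 ?_
      rw [← mul_one (P.ring.valuation r), ← hs, ← map_mul, hfs', hs]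
      exact (P.ring.valuation_le_one_iff _).2 (hPA f.2)
    have hVP : V.toLocalSubring ≤ P.ring.toLocalSubring := by
      refine ⟨hsub, ⟨fun r hr => ?_⟩⟩
      by_contra hr'
      obtain ⟨d, hd⟩ := hnu r hr'
      have hv := (P.ring.valuation_eq_one_iff ⟨r.1, hsub r.2⟩).1 hr
      rw [show ((⟨r.1, hsub r.2⟩ : P.ring) : L) = (T : L) * d from hd] at hv
      exact absurd hv (valuation_mul_lt_one ((hP T).1 ((hp₁ T).2 hy₁)) (hsub d.2)).ne
    exact ValuationSubring.toLocalSubring_injective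
      (V.isMax_toLocalSubring.eq_of_le hVP)
  have h₁ := key P₁ hp₁ hle
  have h₂ := key P₂ hp₂ fun f hf => (hval f hf).choose_spec.2.1.mem
  exact Place.ext (h₁.symm.trans h₂)

end Uniqueness


section Powers

variable {R : Type*} [CommRing R] {q m : ℕ}

theorem mul_cube_pow (hm : q = 3 * m + 1) (v : R) : v * (v ^ 3) ^ m = v ^ q := by
  rw [hm, ← pow_mul, pow_succ']

theorem cube_pow_two_mul_add_one (hm : q = 3 * m + 1) (v : R) :
    (v ^ 3) ^ (2 * m + 1) = v ^ q * v ^ (q + 1) := by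
  rw [← pow_mul, ← pow_add, hm]
  congr 1
  ring

theorem sub_pow_eq_of_eq_pow_char {p e : ℕ} [Fact p.Prime] [CharP R p] (hp : q = p ^ e) (x y : R) :
    (x - y) ^ q = x ^ q - y ^ q := by
  rw [hp, sub_pow_char_pow]

end Powers

/-! ### The plane model of `Y3` -/

section Curve

variable {q : ℕ} [Fact (IsPrimePow q)] {k : Type*} [Field k]

theorem adjoin_xFun_yFun : IntermediateField.adjoin k {xFun q k, yFun q k} = ⊤ := by
  apply IntermediateField.lift_injective
  rw [IntermediateField.lift_adjoin, IntermediateField.lift_top, Set.image_pair]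
  rfl

theorem xFun_pow_add {m : ℕ} (hm : q = 3 * m + 1) :
    xFun q k ^ q + xFun q k * yFun q k ^ m = yFun q k ^ (2 * m + 1) := by
  apply Subtype.ext
  change (uFun q k * vFun q k) ^ q + uFun q k * vFun q k * (vFun q k ^ 3) ^ m =
    (vFun q k ^ 3) ^ (2 * m + 1)
  rw [cube_pow_two_mul_add_one hm, vFun_pow, mul_assoc, mul_cube_pow hm]
  ring

/-- The powers of `v` below `q + 1` are independent over `k[u]`, and `3 < q + 1`. This keeps the
places constructed later nontrivial. -/
theorem vFun_pow_three_ne {m : ℕ} (hm : q = 3 * m + 1) (b : k) :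
    vFun q k ^ 3 ≠ algebraMap k (HermitianField q k) b := by
  intro h
  have hq : 1 < q := (Fact.out : IsPrimePow q).one_lt
  have hmonic : (hermitianPoly q k).Monic := monic_X_pow_sub_C _ (by omega)
  have hdeg : (hermitianPoly q k).natDegree = q + 1 := natDegree_X_pow_sub_C
  have h0 : AdjoinRoot.mk (hermitianPoly q k) (X ^ 3 - C (C b)) = 0 := by
    apply IsFractionRing.injective (HermitianRing q k) (HermitianField q k)
    rw [map_zero, map_sub, map_pow, AdjoinRoot.mk_X, AdjoinRoot.mk_C, map_sub, map_pow]
    change vFun q k ^ 3 - _ = 0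
    rw [h, IsScalarTower.algebraMap_apply k (HermitianRing q k) (HermitianField q k)]
    exact sub_self _
  refine AdjoinRoot.mk_ne_zero_of_natDegree_lt hmonic (X_pow_sub_C_ne_zero (by norm_num) _) ?_ h0
  rw [natDegree_X_pow_sub_C, hdeg]
  omega

variable {P : Place k (Y3 q k)}

theorem Place.HasValue.xFun_pow_add {m : ℕ} (hm : q = 3 * m + 1) {a b : k}
    (hx : P.HasValue (xFun q k) a) (hy : P.HasValue (yFun q k) b) :
    a ^ q + a * b ^ m = b ^ (2 * m + 1) := by
  have h := (hx.pow q).add (hx.mul (hy.pow m))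
  rw [MaxCurve.xFun_pow_add hm] at h
  exact h.unique (hy.pow _)

/-- Subtracting the curve equation at `(a, b)` and using `x ^ q - a ^ q = (x - a) ^ q` gives `(x -
a) * ((x - a) ^ (q - 1) + y ^ m) = (y - b) * w`; the second factor has value `b ^ m ≠ 0`. -/
theorem Place.eq_of_hasValue_xFun_yFun {p e m : ℕ} [Fact p.Prime] [CharP k p]
    (hp : q = p ^ e) (hm : q = 3 * m + 1) {P₁ P₂ : Place k (Y3 q k)} {a b : k} (hb : b ≠ 0)
    (hx₁ : P₁.HasValue (xFun q k) a) (hy₁ : P₁.HasValue (yFun q k) b)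
    (hx₂ : P₂.HasValue (xFun q k) a) (hy₂ : P₂.HasValue (yFun q k) b) : P₁ = P₂ := by
  have hq : 1 < q := (Fact.out : IsPrimePow q).one_lt
  have : CharP (Y3 q k) p := charP_of_injective_algebraMap (algebraMap k (Y3 q k)).injective p
  set B := Algebra.adjoin k {xFun q k, yFun q k} with hB
  have hxB : xFun q k ∈ B := Algebra.subset_adjoin (by simp)
  have hyB : yFun q k ∈ B := Algebra.subset_adjoin (by simp)
  obtain ⟨⟨s₁, hs₁⟩, h₁⟩ :=
    sub_dvd_pow_sub_pow (⟨yFun q k, hyB⟩ : B) (algebraMap k B b) m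
  obtain ⟨⟨s₂, hs₂⟩, h₂⟩ :=
    sub_dvd_pow_sub_pow (⟨yFun q k, hyB⟩ : B) (algebraMap k B b) (2 * m + 1)
  replace h₁ : yFun q k ^ m - algebraMap k _ b ^ m = (yFun q k - algebraMap k _ b) * s₁ :=
    congrArg Subtype.val h₁
  replace h₂ : yFun q k ^ (2 * m + 1) - algebraMap k _ b ^ (2 * m + 1) =
      (yFun q k - algebraMap k _ b) * s₂ := congrArg Subtype.val h₂
  have hg : (xFun q k - algebraMap k _ a) ^ (q - 1) + yFun q k ^ m ∈ B :=
    add_mem (pow_mem (sub_mem hxB (B.algebraMap_mem a)) _) (pow_mem hyB _)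
  have hw : s₂ - algebraMap k _ a * s₁ ∈ B := sub_mem hs₂ (mul_mem (B.algebraMap_mem a) hs₁)
  refine Place.eq_of_hasValue adjoin_xFun_yFun hx₁ hy₁ hx₂ hy₂ hg hw ?_ ?_
  · have hF : (xFun q k - algebraMap k _ a) * (xFun q k - algebraMap k _ a) ^ (q - 1) =
        xFun q k ^ q - algebraMap k _ a ^ q := by
      rw [← pow_succ', Nat.sub_add_cancel hq.le, sub_pow_eq_of_eq_pow_char hp]
    have hab := congrArg (algebraMap k (Y3 q k)) (hx₁.xFun_pow_add hm hy₁)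
    simp only [map_add, map_mul, map_pow] at hab
    linear_combination hF + xFun_pow_add (q := q) (k := k) hm - hab -
      algebraMap k _ a * h₁ + h₂
  · have hv : P₁.HasValue ((xFun q k - algebraMap k _ a) ^ (q - 1) + yFun q k ^ m)
        ((a + -a) ^ (q - 1) + b ^ m) := by
      refine Place.HasValue.add (Place.HasValue.pow ?_ _) (hy₁.pow m)
      rw [sub_eq_add_neg, ← map_neg]
      exact hx₁.add (Place.hasValue_algebraMap _)
    apply hv.valuation_eq_one
    rw [add_neg_cancel, zero_pow (by omega), zero_add]
    exact pow_ne_zero _ hb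

end Curve

/-! ### A place over every point with `y ≠ 0` -/

section Existence

variable {k L : Type*} [Field k] [Field L]

/-- A homomorphism from a subring of `L` to a field is the reduction at some valuation ring. -/
theorem exists_valuationSubring_of_ringHom {R : Type*} [CommRing R] [Algebra R L]
    (hR : Function.Injective (algebraMap R L)) (φ : R →+* k) :
    ∃ V : ValuationSubring L, (∀ r : R, algebraMap R L r ∈ V) ∧
      ∀ r : R, φ r = 0 → V.valuation (algebraMap R L r) < 1 := by
  let e : R ≃+* (algebraMap R L).range := RingEquiv.ofBijective (algebraMap R L).rangeRestrict
    ⟨fun r s h => hR (congrArg Subtype.val h), (algebraMap R L).rangeRestrict_surjective⟩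
  -- The kernel of `φ` is a proper ideal, so some valuation ring contains the image of `R` and has
  -- that ideal among its nonunits.
  obtain ⟨V, hV, hV'⟩ := Ideal.image_subset_nonunits_valuationSubring _
    (RingHom.ker_ne_top (φ.comp e.symm.toRingHom))
  refine ⟨V, fun r => hV ⟨r, rfl⟩, fun r hr => ?_⟩
  refine hV' ⟨e r, ?_, rfl⟩
  simpa [RingHom.mem_ker] using hr

theorem valuation_comap_lt_one_iff {M : Type*} [Field M] (V : ValuationSubring M) (f : L →+* M)
    (z : L) : (V.comap f).valuation z < 1 ↔ V.valuation (f z) < 1 := by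
  rw [← ValuationSubring.mem_nonunits_iff, ← ValuationSubring.mem_nonunits_iff,
    ValuationSubring.mem_nonunits_iff_or, ValuationSubring.mem_nonunits_iff_or,
    ValuationSubring.mem_comap, map_inv₀, map_eq_zero]

/-- A cube root `v` of `b` and `u = a / v` give a point of the Hermitian curve; a valuation ring
centred there is restricted to `Y3`. -/
theorem exists_place_of_point {q : ℕ} [Fact (IsPrimePow q)] [IsAlgClosed k] {m : ℕ}
    (hm : q = 3 * m + 1) {a b : k} (hb : b ≠ 0) (hab : a ^ q + a * b ^ m = b ^ (2 * m + 1)) :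
    ∃ P : Place k (Y3 q k), P.HasValue (xFun q k) a ∧ P.HasValue (yFun q k) b := by
  obtain ⟨v, rfl⟩ := IsAlgClosed.exists_pow_nat_eq b (n := 3) (by norm_num)
  have hv : v ≠ 0 := by rintro rfl; simp at hb
  obtain ⟨u, rfl⟩ : ∃ u, a = u * v := ⟨a / v, by field_simp⟩
  have huv : v ^ (q + 1) = u ^ q + u := by
    apply mul_left_cancel₀ (pow_ne_zero q hv)
    rw [← cube_pow_two_mul_add_one hm, ← hab, mul_assoc u, mul_cube_pow hm]
    ring
  let φ : HermitianRing q k →+* k := AdjoinRoot.lift (evalRingHom u) v (by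
    rw [hermitianPoly, eval₂_sub, eval₂_pow, eval₂_X, eval₂_C, huv]
    simp)
  have hinj := IsFractionRing.injective (HermitianRing q k) (HermitianField q k)
  obtain ⟨V, hV, hV'⟩ := exists_valuationSubring_of_ringHom hinj φ
  have htower := IsScalarTower.algebraMap_apply k (HermitianRing q k) (HermitianField q k)
  have hφc (c : k) : φ (algebraMap k (HermitianRing q k) c) = c := by
    change φ (AdjoinRoot.of _ (C c)) = c
    simp [φ]
  have hval (r : HermitianRing q k) : V.valuation (algebraMap _ (HermitianField q k) r -
      algebraMap k (HermitianField q k) (φ r)) < 1 := by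
    rw [htower, ← map_sub]
    apply hV'
    rw [map_sub, hφc, sub_self]
  let W : ValuationSubring (Y3 q k) := V.comap (algebraMap (Y3 q k) (HermitianField q k))
  have hx : W.valuation (xFun q k - algebraMap k _ (u * v)) < 1 := by
    rw [valuation_comap_lt_one_iff]
    have h := hval (AdjoinRoot.of _ X * AdjoinRoot.root _)
    simpa [φ, xFun, uFun, vFun] using h
  have hy : W.valuation (yFun q k - algebraMap k _ (v ^ 3)) < 1 := by
    rw [valuation_comap_lt_one_iff]
    have h := hval (AdjoinRoot.root _ ^ 3)
    simpa [φ, yFun, vFun] using h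
  refine ⟨⟨W, fun c => ?_, fun hW => ?_⟩, hx, hy⟩
  · rw [ValuationSubring.mem_comap, ← IsScalarTower.algebraMap_apply, htower]
    exact hV _
  -- If the ring were the whole field, its only nonunit would be 0 and `y` would be constant.
  · rw [← ValuationSubring.mem_nonunits_iff, ValuationSubring.mem_nonunits_iff_or, hW] at hy
    rcases hy with hy | hy
    · exact vFun_pow_three_ne hm (v ^ 3) (congrArg Subtype.val (sub_eq_zero.1 hy))
    · exact hy trivial

end Existence


/-! ### Counting roots over an algebraically closed field -/

section Counting

theorem encard_eq_of_bijOn {α β : Type*} {f : α → β} {s : Set α} {t : Set β}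
    (h : Set.BijOn f s t) : s.encard = t.encard := by
  rw [← h.image_eq, h.injOn.encard_image]

variable {k : Type*} [Field k] [IsAlgClosed k]

theorem exists_isPrimitiveRoot {n : ℕ} (hn : (n : k) ≠ 0) : ∃ z : k, IsPrimitiveRoot z n := by
  have : NeZero (n : k) := ⟨hn⟩
  exact HasEnoughRootsOfUnity.exists_primitiveRoot k n

theorem card_nthRoots_toFinset [DecidableEq k] {n : ℕ} (hn : (n : k) ≠ 0) {c : k} (hc : c ≠ 0) :
    (nthRoots n c).toFinset.card = n := by
  obtain ⟨z, hz⟩ := exists_isPrimitiveRoot hn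
  have hn0 : 0 < n := Nat.pos_of_ne_zero fun h => hn (by simp [h])
  rw [Multiset.toFinset_card_of_nodup (hz.nthRoots_nodup hc), hz.card_nthRoots,
    if_pos (IsAlgClosed.exists_pow_nat_eq c hn0)]

end Counting

/-! ### Places with prescribed `α` -/

section Alpha

variable {q : ℕ} [Fact (IsPrimePow q)] {k : Type*} [Field k]

/-- The fallback branches only yield `0`, `1`, `∞`, and uniqueness of values makes the choice of
`(a, b)` irrelevant. -/
theorem alphaAt_eq_coe_iff {P : Place k (Y3 q k)} {α : k} (h0 : α ≠ 0) (h1 : α ≠ 1) :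
    alphaAt P = (α : OnePoint k) ↔ ∃ a b : k, a ≠ 0 ∧ P.HasValue (xFun q k) a ∧
      P.HasValue (yFun q k) b ∧ b ^ ((q + 2) / 3) / a = α := by
  unfold alphaAt
  split_ifs with h h2 h3
  · have hc := h.choose_spec
    constructor
    · intro hα
      exact ⟨_, _, hc.1, hc.2.1, hc.2.2, OnePoint.coe_injective hα⟩
    · rintro ⟨a, b, -, hx, hy, rfl⟩
      rw [hc.2.1.unique hx, hc.2.2.unique hy]
  all_goals
    refine ⟨fun hα => ?_, fun ⟨a, b, ha, hx, hy, _⟩ => (h ⟨(a, b), ha, hx, hy⟩).elim⟩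
  · exact (h0 (OnePoint.coe_injective hα).symm).elim
  · exact (h1 (OnePoint.coe_injective hα).symm).elim
  · exact (OnePoint.infty_ne_coe α hα).elim

theorem curve_eq_iff {m : ℕ} (hm : q = 3 * m + 1) {α b : k} (h0 : α ≠ 0) (hb : b ≠ 0) :
    (b ^ (m + 1) / α) ^ q + b ^ (m + 1) / α * b ^ m = b ^ (2 * m + 1) ↔
      b ^ (m * (3 * m + 2)) = α ^ (3 * m) * (α - 1) := by
  subst hm
  have hα : α ^ (3 * m + 1) ≠ 0 := pow_ne_zero _ h0
  have hb' : b ^ (2 * m + 1) ≠ 0 := pow_ne_zero _ hb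
  have e1 : (b ^ (m + 1) / α) ^ (3 * m + 1) * α ^ (3 * m + 1) =
      b ^ (2 * m + 1) * b ^ (m * (3 * m + 2)) := by
    rw [div_pow, div_mul_cancel₀ _ hα, ← pow_mul, ← pow_add]
    congr 1
    ring
  have e2 : b ^ (m + 1) / α * b ^ m * α ^ (3 * m + 1) = b ^ (2 * m + 1) * α ^ (3 * m) := by
    field_simp
    ring
  rw [← mul_left_inj' hα, add_mul, e1, e2, ← mul_add, mul_right_inj' hb', pow_succ α]
  constructor <;> intro h <;> linear_combination h

theorem encard_places_alphaAt_mem [IsAlgClosed k] [DecidableEq k] {p e m : ℕ} [Fact p.Prime]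
    [CharP k p] (hp : q = p ^ e) (hm : q = 3 * m + 1) (S : Finset k)
    (hS : ∀ α ∈ S, α ≠ 0 ∧ α ≠ 1) :
    {P : Place k (Y3 q k) | ∃ α ∈ S, alphaAt P = (α : OnePoint k)}.encard =
      (((q ^ 2 - 1) / 3 * S.card : ℕ) : ℕ∞) := by
  have hq : 1 < q := (Fact.out : IsPrimePow q).one_lt
  have hm2 : (q + 2) / 3 = m + 1 := by omega
  have hN : (q ^ 2 - 1) / 3 = m * (3 * m + 2) := by
    have : q ^ 2 - 1 = m * (3 * m + 2) * 3 := by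
      rw [hm, Nat.sub_eq_iff_eq_add (Nat.one_le_pow _ _ (by omega))]
      ring
    rw [this, Nat.mul_div_cancel _ (by norm_num)]
  have hqk : (q : k) = 0 := by
    have he : e ≠ 0 := by rintro rfl; simp at hp; omega
    rw [hp, Nat.cast_pow, CharP.cast_eq_zero, zero_pow he]
  -- Separability: three times this number is `q ^ 2 - 1`, which is `-1` in `k`.
  have hNk : ((m * (3 * m + 2) : ℕ) : k) ≠ 0 := by
    intro h
    rw [hm] at hqk
    push_cast at h hqk
    have : (1 : k) = 0 := by linear_combination (3 * (m : k) + 1) * hqk - 3 * h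
    exact one_ne_zero this
  let D : Finset (Σ _ : k, k) :=
    S.sigma fun α => (nthRoots (m * (3 * m + 2)) (α ^ (3 * m) * (α - 1))).toFinset
  have hN0 : 0 < m * (3 * m + 2) := Nat.mul_pos (by omega) (by omega)
  have hD : D.card = m * (3 * m + 2) * S.card := by
    rw [Finset.card_sigma, Finset.sum_const_nat (m := m * (3 * m + 2)), mul_comm]
    intro α hα
    exact card_nthRoots_toFinset hNk
      (mul_ne_zero (pow_ne_zero _ (hS α hα).1) (sub_ne_zero.2 (hS α hα).2))
  have hmemD (d : Σ _ : k, k) : d ∈ D ↔ d.1 ∈ S ∧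
      d.2 ^ (m * (3 * m + 2)) = d.1 ^ (3 * m) * (d.1 - 1) := by
    rw [Finset.mem_sigma, Multiset.mem_toFinset, mem_nthRoots hN0]
  have hne (d : Σ _ : k, k) (hd : d ∈ D) : d.2 ≠ 0 := by
    intro h
    obtain ⟨h1, h2⟩ := (hmemD d).1 hd
    rw [h, zero_pow hN0.ne'] at h2
    exact mul_ne_zero (pow_ne_zero _ (hS _ h1).1) (sub_ne_zero.2 (hS _ h1).2) h2.symm
  have hex : ∀ P : Place k (Y3 q k), ∃ d : Σ _ : k, k,
      (∃ α ∈ S, alphaAt P = (α : OnePoint k)) → d ∈ D ∧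
        P.HasValue (xFun q k) (d.2 ^ (m + 1) / d.1) ∧ P.HasValue (yFun q k) d.2 := by
    intro P
    by_cases hP : ∃ α ∈ S, alphaAt P = (α : OnePoint k)
    · obtain ⟨α, hα, hPα⟩ := hP
      obtain ⟨h0, h1⟩ := hS α hα
      obtain ⟨a, b, ha, hx, hy, hab⟩ := (alphaAt_eq_coe_iff h0 h1).1 hPα
      rw [hm2] at hab
      have hb : b ≠ 0 := by
        rintro rfl
        exact h0 (by rw [← hab]; simp)
      have ha' : a = b ^ (m + 1) / α := by
        rw [← hab]
        field_simp
      rw [ha'] at hx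
      exact ⟨⟨α, b⟩, fun _ => ⟨(hmemD _).2 ⟨hα, (curve_eq_iff hm h0 hb).1
        (hx.xFun_pow_add hm hy)⟩, hx, hy⟩⟩
    -- A dummy value, so that `g` is defined on all places.
    · exact ⟨⟨0, 0⟩, fun h => (hP h).elim⟩
  choose g hg using hex
  have hbij : Set.BijOn g {P : Place k (Y3 q k) | ∃ α ∈ S, alphaAt P = (α : OnePoint k)}
      (D : Set (Σ _ : k, k)) := by
    refine ⟨fun P hP => (hg P hP).1, fun P₁ h₁ P₂ h₂ h => ?_, fun d hd => ?_⟩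
    · obtain ⟨hd₁, hx₁, hy₁⟩ := hg P₁ h₁
      obtain ⟨-, hx₂, hy₂⟩ := hg P₂ h₂
      rw [← h] at hx₂ hy₂
      exact Place.eq_of_hasValue_xFun_yFun hp hm (hne _ hd₁) hx₁ hy₁ hx₂ hy₂
    · obtain ⟨hdS, hdN⟩ := (hmemD d).1 hd
      obtain ⟨h0, h1⟩ := hS _ hdS
      obtain ⟨P, hx, hy⟩ :=
        exists_place_of_point hm (hne d hd) ((curve_eq_iff hm h0 (hne d hd)).2 hdN)
      have hb : d.2 ^ (m + 1) ≠ 0 := pow_ne_zero _ (hne d hd)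
      have hPS : ∃ α ∈ S, alphaAt P = (α : OnePoint k) := by
        refine ⟨d.1, hdS, (alphaAt_eq_coe_iff h0 h1).2 ⟨_, _, div_ne_zero hb h0, hx, hy, ?_⟩⟩
        rw [hm2]
        field_simp
      refine ⟨P, hPS, ?_⟩
      obtain ⟨hd', hx', hy'⟩ := hg P hPS
      have e2 : (g P).2 = d.2 := hy'.unique hy
      have e1 := hx'.unique hx
      rw [e2, div_eq_mul_inv, div_eq_mul_inv] at e1
      exact Sigma.ext (inv_injective (mul_left_cancel₀ hb e1)) (heq_of_eq e2)
  rw [encard_eq_of_bijOn hbij, Set.encard_coe_eq_coe_finsetCard, hD, hN]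

end Alpha


/-! ### The two orders in terms of the ratio -/

section Orders

variable {k : Type*} [Field k] {ζ : k}

theorem sq_add_self_add_one (hζ : IsPrimitiveRoot ζ 3) : ζ ^ 2 + ζ + 1 = 0 := by
  have h : (ζ - 1) * (ζ ^ 2 + ζ + 1) = 0 := by linear_combination hζ.pow_eq_one
  exact (mul_eq_zero.1 h).resolve_left (sub_ne_zero.2 (hζ.ne_one (by norm_num)))

/-- Evaluating `X ^ 2 + X + 1` at 1 gives `3 = (1 - ζ) * (1 - ζ ^ 2)`. -/
theorem three_ne_zero_of_isPrimitiveRoot (hζ : IsPrimitiveRoot ζ 3) : (3 : k) ≠ 0 := by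
  have h1 : 1 - ζ ≠ 0 := sub_ne_zero.2 (hζ.ne_one (by norm_num)).symm
  have h2 : 1 - ζ ^ 2 ≠ 0 :=
    sub_ne_zero.2 (hζ.pow_ne_one_of_pos_of_lt (by norm_num) (by norm_num)).symm
  have h3 : (3 : k) = (1 - ζ) * (1 - ζ ^ 2) := by
    linear_combination sq_add_self_add_one hζ - hζ.pow_eq_one
  rw [h3]
  exact mul_ne_zero h1 h2

theorem sub_sq_ne_zero (hζ : IsPrimitiveRoot ζ 3) : ζ - ζ ^ 2 ≠ 0 := by
  rw [show ζ - ζ ^ 2 = ζ * (1 - ζ) by ring]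
  exact mul_ne_zero (hζ.ne_zero (by norm_num)) (sub_ne_zero.2 (hζ.ne_one (by norm_num)).symm)

/-- The quotient whose powers detect the zeros of `calP` and `calQ`. -/
def ratio (ζ α : k) : k := (α + ζ) / (α + ζ ^ 2)

theorem Admissible.add_sq_ne_zero {α : k} (hα : Admissible ζ α) : α + ζ ^ 2 ≠ 0 :=
  fun h => hα.2.2.2 (eq_neg_of_add_eq_zero_left h)

/-- The difference `(α + ζ) ^ 3 - (α + ζ ^ 2) ^ 3` is `3 * (ζ - ζ ^ 2) * α * (α - 1)`, the
denominator of `calP`. -/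
theorem ratio_pow_three_ne_one (hζ : IsPrimitiveRoot ζ 3) {α : k} (hα : Admissible ζ α) :
    ratio ζ α ^ 3 ≠ 1 := by
  intro h
  rw [ratio, div_pow, div_eq_one_iff_eq (pow_ne_zero _ hα.add_sq_ne_zero)] at h
  have h1 : 3 * (ζ - ζ ^ 2) * (α * (α - 1)) = 0 := by
    linear_combination h + (3 * α * ζ + ζ ^ 3) * hζ.pow_eq_one
  exact mul_ne_zero (mul_ne_zero (three_ne_zero_of_isPrimitiveRoot hζ) (sub_sq_ne_zero hζ))
    (mul_ne_zero hα.1 (sub_ne_zero.2 hα.2.1)) h1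

/-- Counting admissible elements by their ratio. -/
theorem encard_admissible_ratio (hζ : IsPrimitiveRoot ζ 3) {p : k → Prop}
    (hp : ∀ β, p β → β ≠ 0 ∧ β ^ 3 ≠ 1) :
    {α | Admissible ζ α ∧ p (ratio ζ α)}.encard = {β | p β}.encard := by
  have hz := sq_add_self_add_one hζ
  have hz0 := sub_sq_ne_zero hζ
  refine encard_eq_of_bijOn (f := ratio ζ) ⟨fun α hα => hα.2, ?_, ?_⟩
  · rintro α ⟨hα, -⟩ α' ⟨hα', -⟩ h
    rw [ratio, ratio, div_eq_div_iff hα.add_sq_ne_zero hα'.add_sq_ne_zero] at h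
    refine mul_left_cancel₀ hz0 ?_
    linear_combination -h
  · intro β hβ
    obtain ⟨h0, h3⟩ := hp β hβ
    have hβ1 : 1 - β ≠ 0 := sub_ne_zero.2 fun h => h3 (by rw [← h, one_pow])
    have hβζ : β ≠ ζ := fun h => h3 (by rw [h, hζ.pow_eq_one])
    have hβζ2 : β ≠ ζ ^ 2 := fun h => h3 (by
      rw [h]; linear_combination (ζ ^ 3 + 1) * hζ.pow_eq_one)
    -- The inverse Möbius map is `β ↦ (ζ ^ 2 * β - ζ) / (1 - β)`.
    have e1 : (ζ ^ 2 * β - ζ) / (1 - β) + ζ = (ζ ^ 2 - ζ) * β / (1 - β) := by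
      field_simp
      ring
    have e2 : (ζ ^ 2 * β - ζ) / (1 - β) + ζ ^ 2 = (ζ ^ 2 - ζ) / (1 - β) := by
      field_simp
      ring
    have hz0' : ζ ^ 2 - ζ ≠ 0 := by rwa [← neg_sub, neg_ne_zero]
    have hr : ratio ζ ((ζ ^ 2 * β - ζ) / (1 - β)) = β := by
      rw [ratio, e1, e2, div_div_div_cancel_right₀ hβ1, mul_div_cancel_left₀ _ hz0']
    refine ⟨(ζ ^ 2 * β - ζ) / (1 - β), ⟨⟨?_, ?_, ?_, ?_⟩, hr.symm ▸ hβ⟩, hr⟩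
    · refine div_ne_zero (fun h => hβζ2 ?_) hβ1
      linear_combination ζ * h - β * hζ.pow_eq_one
    · rw [Ne, div_eq_one_iff_eq hβ1]
      intro h
      refine hβζ ?_
      linear_combination (-ζ ^ 2) * h + (ζ * β - 1) * hζ.pow_eq_one + (β - 1) * hz
    · intro h
      refine mul_ne_zero hz0' h0 ?_
      rw [h, neg_add_cancel] at e1
      exact (div_eq_zero_iff.1 e1.symm).resolve_right hβ1
    · intro h
      rw [h, neg_add_cancel] at e2
      exact hz0' ((div_eq_zero_iff.1 e2.symm).resolve_right hβ1)

theorem calP_eq_zero_iff (hζ : IsPrimitiveRoot ζ 3) {α : k} (hα : Admissible ζ α) (j : ℕ) :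
    calP ζ ((j : ℤ) + 1) α = 0 ↔ (ratio ζ α ^ 3) ^ (j + 1) = 1 := by
  have hden : 3 * (ζ - ζ ^ 2) * α * (α - 1) ≠ 0 :=
    mul_ne_zero (mul_ne_zero (mul_ne_zero (three_ne_zero_of_isPrimitiveRoot hζ)
      (sub_sq_ne_zero hζ)) hα.1) (sub_ne_zero.2 hα.2.1)
  rw [calP, div_eq_zero_iff, or_iff_left hden,
    show (3 * ((j : ℤ) + 1)) = ((3 * (j + 1) : ℕ) : ℤ) by push_cast; ring, zpow_natCast,
    zpow_natCast, sub_eq_zero, ← pow_mul, ratio, div_pow,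
    div_eq_one_iff_eq (pow_ne_zero _ hα.add_sq_ne_zero)]

/-- Replacing `α` by `1 - α` swaps `α + ζ` and `α + ζ ^ 2` up to sign, and the coefficients satisfy
`(1 - ζ ^ 2) / (1 - ζ) = 1 + ζ = -ζ ^ 2`. -/
theorem calQ_eq_zero_iff (hζ : IsPrimitiveRoot ζ 3) {α : k} (hα : Admissible ζ α) (K : ℕ) :
    calQ ζ ((K : ℤ) + 1) (1 - α) = 0 ↔ ratio ζ α ^ (3 * K + 2) = ζ := by
  have hz := sq_add_self_add_one hζ
  have h3 := three_ne_zero_of_isPrimitiveRoot hζ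
  have h1 : 1 - ζ ≠ 0 := sub_ne_zero.2 (hζ.ne_one (by norm_num)).symm
  have hζ0 : ζ ≠ 0 := hζ.ne_zero (by norm_num)
  have hden : 1 - α - 1 ≠ 0 := by
    rw [show 1 - α - 1 = -α by ring]
    exact neg_ne_zero.2 hα.1
  have e1 : 1 - α + ζ = -1 * (α + ζ ^ 2) := by linear_combination hz
  have e2 : 1 - α + ζ ^ 2 = -1 * (α + ζ) := by linear_combination hz
  rw [calQ, div_eq_zero_iff, or_iff_left hden,
    show (3 * ((K : ℤ) + 1) - 1) = ((3 * K + 2 : ℕ) : ℤ) by push_cast; ring, zpow_natCast,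
    zpow_natCast, e1, e2, mul_pow, mul_pow (-1) (α + ζ), ratio, div_pow,
    div_eq_iff (pow_ne_zero _ hα.add_sq_ne_zero)]
  have hs : ((-1 : k) ^ (3 * K + 2)) ≠ 0 := pow_ne_zero _ (by simp)
  generalize (-1 : k) ^ (3 * K + 2) = s at hs
  generalize (α + ζ) ^ (3 * K + 2) = A
  generalize (α + ζ ^ 2) ^ (3 * K + 2) = B
  have e3 : (1 - ζ) / 3 * (s * B) + (1 - ζ ^ 2) / 3 * (s * A) =
      (1 - ζ) / 3 * s * ζ ^ 2 * (ζ * B - A) := by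
    field_simp
    linear_combination (-(1 - ζ) * B) * hζ.pow_eq_one + (1 - ζ) * A * hz
  rw [e3, mul_eq_zero, or_iff_right
    (mul_ne_zero (mul_ne_zero (div_ne_zero h1 h3) hs) (pow_ne_zero 2 hζ0)), sub_eq_zero, eq_comm]

theorem sInf_image_natCast_eq_natCast_iff {S : Set ℕ} {i : ℕ} :
    sInf ((fun n : ℕ => (n : ℕ∞)) '' S) = (i : ℕ∞) ↔ IsLeast S i := by
  rcases S.eq_empty_or_nonempty with rfl | hS
  · simp [IsLeast]
  · rw [sInf_image, ← ENat.natCast_sInf hS, Nat.cast_inj]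
    exact ⟨fun h => h ▸ ⟨Nat.sInf_mem hS, fun j hj => Nat.sInf_le hj⟩, fun h => h.csInf_eq⟩

theorem sInf_image_natCast_eq_top_iff {S : Set ℕ} :
    sInf ((fun n : ℕ => (n : ℕ∞)) '' S) = ⊤ ↔ S = ∅ := by
  simp [sInf_eq_top, Set.eq_empty_iff_forall_notMem]

/-- Only exponents `j + 1 ≥ 2` are tested, so `g ≠ 1` is what makes the least one the order. -/
theorem orderOf_eq_succ_iff {G : Type*} [Monoid G] {g : G} (hg : g ≠ 1) {i : ℕ} (hi : 0 < i) :
    IsLeast {j : ℕ | 0 < j ∧ g ^ (j + 1) = 1} i ↔ orderOf g = i + 1 := by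
  constructor
  · rintro ⟨⟨-, h⟩, hmin⟩
    have hdvd := orderOf_dvd_of_pow_eq_one h
    have hpos : 0 < orderOf g := Nat.pos_of_dvd_of_pos hdvd (by omega)
    have hone : orderOf g ≠ 1 := fun h => hg (orderOf_eq_one_iff.1 h)
    have hle := Nat.le_of_dvd (by omega) hdvd
    have := hmin (a := orderOf g - 1) ⟨by omega, by
      rw [Nat.sub_add_cancel hpos, pow_orderOf_eq_one]⟩
    omega
  · intro h
    refine ⟨⟨hi, h ▸ pow_orderOf_eq_one g⟩, fun j hj => ?_⟩
    have := Nat.le_of_dvd (by omega) (orderOf_dvd_of_pow_eq_one hj.2)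
    omega

theorem pOrder_eq_iff (hζ : IsPrimitiveRoot ζ 3) {α : k} (hα : Admissible ζ α) {i : ℕ}
    (hi : 0 < i) : pOrder ζ α = i ↔ orderOf (ratio ζ α ^ 3) = i + 1 := by
  rw [pOrder, sInf_image_natCast_eq_natCast_iff,
    ← orderOf_eq_succ_iff (ratio_pow_three_ne_one hζ hα) hi]
  simp only [calP_eq_zero_iff hζ hα]

theorem qOrder_eq_iff (hζ : IsPrimitiveRoot ζ 3) {α : k} (hα : Admissible ζ α) {K : ℕ} :
    qOrder ζ α = K ↔ IsLeast {K : ℕ | 0 < K ∧ ratio ζ α ^ (3 * K + 2) = ζ} K := by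
  rw [qOrder, sInf_image_natCast_eq_natCast_iff]
  simp only [calQ_eq_zero_iff hζ hα]

theorem qOrder_eq_top_iff (hζ : IsPrimitiveRoot ζ 3) {α : k} (hα : Admissible ζ α) :
    qOrder ζ α = ⊤ ↔ ¬ ∃ K : ℕ, 0 < K ∧ ratio ζ α ^ (3 * K + 2) = ζ := by
  rw [qOrder, sInf_image_natCast_eq_top_iff, Set.eq_empty_iff_forall_notMem]
  simp only [calQ_eq_zero_iff hζ hα, Set.mem_ofPred_eq, not_exists]

theorem exists_qOrder_eq_iff (hζ : IsPrimitiveRoot ζ 3) {α : k} (hα : Admissible ζ α) :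
    (∃ K : ℕ, qOrder ζ α = K) ↔ ∃ K : ℕ, 0 < K ∧ ratio ζ α ^ (3 * K + 2) = ζ := by
  rw [← not_iff_not, ← qOrder_eq_top_iff hζ hα]
  cases h : qOrder ζ α with
  | top => simp
  | coe K => simp

end Orders

/-! ### Counting the ratios -/

section Roots

variable {k : Type*} [Field k] {ζ : k}

theorem dvd_of_pow_eq (hζ : IsPrimitiveRoot ζ 3) {β : k} {K : ℕ} (h : β ^ (3 * K + 2) = ζ) :
    orderOf (β ^ 3) ∣ 3 * K + 2 := by
  apply orderOf_dvd_of_pow_eq_one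
  rw [← pow_mul, mul_comm, pow_mul, h, hζ.pow_eq_one]

theorem mul_pow_three_mul_add_two (hζ : IsPrimitiveRoot ζ 3) (β : k) (K : ℕ) :
    (ζ * β) ^ (3 * K + 2) = ζ ^ 2 * β ^ (3 * K + 2) := by
  rw [mul_pow, pow_add ζ, pow_mul, hζ.pow_eq_one, one_pow, one_mul]

theorem pow_eq_iff_mul_pow_eq_one (hζ : IsPrimitiveRoot ζ 3) {β : k} {K : ℕ} :
    β ^ (3 * K + 2) = ζ ↔ (ζ * β) ^ (3 * K + 2) = 1 := by
  rw [mul_pow_three_mul_add_two hζ]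
  constructor
  · intro h
    rw [h, ← pow_succ, hζ.pow_eq_one]
  · intro h
    linear_combination ζ * h - β ^ (3 * K + 2) * hζ.pow_eq_one

/-- The order of `ζ * β` divides `3 * K + 2`, so it is prime to 3 and survives cubing, which removes
`ζ`. -/
theorem orderOf_mul_eq (hζ : IsPrimitiveRoot ζ 3) {β : k} {K : ℕ} (h : β ^ (3 * K + 2) = ζ) :
    orderOf (ζ * β) = orderOf (β ^ 3) := by
  have hdvd : orderOf (ζ * β) ∣ 3 * K + 2 :=
    orderOf_dvd_of_pow_eq_one ((pow_eq_iff_mul_pow_eq_one hζ).1 h)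
  have hcop : (orderOf (ζ * β)).Coprime 3 := by
    refine Nat.Coprime.coprime_dvd_left hdvd ?_
    rw [Nat.coprime_comm, Nat.Prime.coprime_iff_not_dvd Nat.prime_three]
    omega
  rw [← hcop.orderOf_pow, mul_pow, hζ.pow_eq_one, one_mul]

theorem pow_eq_iff_dvd (hζ : IsPrimitiveRoot ζ 3) {β : k} {K : ℕ} (h : β ^ (3 * K + 2) = ζ)
    (K' : ℕ) : β ^ (3 * K' + 2) = ζ ↔ orderOf (β ^ 3) ∣ 3 * K' + 2 := by
  rw [pow_eq_iff_mul_pow_eq_one hζ, ← orderOf_dvd_iff_pow_eq_one, orderOf_mul_eq hζ h]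

variable [DecidableEq k]

theorem orderOf_pow_three_eq_and_exists_iff (hζ : IsPrimitiveRoot ζ 3) {n : ℕ} (hn : 0 < n)
    (hn3 : n % 3 ≠ 0) {β : k} :
    (orderOf (β ^ 3) = n ∧ ∃ K : ℕ, 0 < K ∧ β ^ (3 * K + 2) = ζ) ↔
      β ∈ (primitiveRoots n k).image (ζ ^ 2 * ·) := by
  rw [Finset.mem_image]
  constructor
  · rintro ⟨h, K, -, hK⟩
    refine ⟨ζ * β, (mem_primitiveRoots hn).2 ?_, ?_⟩
    · rw [← h, ← orderOf_mul_eq hζ hK]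
      exact IsPrimitiveRoot.orderOf _
    · linear_combination β * hζ.pow_eq_one
  · rintro ⟨δ, hδ, rfl⟩
    have hδ := (mem_primitiveRoots hn).1 hδ
    have e : ζ * (ζ ^ 2 * δ) = δ := by linear_combination δ * hζ.pow_eq_one
    have hcop : (orderOf δ).Coprime 3 := by
      rw [← hδ.eq_orderOf, Nat.coprime_comm, Nat.Prime.coprime_iff_not_dvd Nat.prime_three]
      omega
    refine ⟨?_, ?_⟩
    · rw [show (ζ ^ 2 * δ) ^ 3 = δ ^ 3 by
        linear_combination δ ^ 3 * (ζ ^ 3 + 1) * hζ.pow_eq_one, hcop.orderOf_pow, hδ.eq_orderOf]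
    -- The multiples `5 * n` and `4 * n` are 2 mod 3; the smaller `2 * n` and `n` would give `K = 0`
    -- for `n = 1` and `n = 2`.
    · obtain ⟨K, hK0, hK⟩ : ∃ K, 0 < K ∧ n ∣ 3 * K + 2 := by
        rcases (by omega : n % 3 = 1 ∨ n % 3 = 2) with h | h
        · exact ⟨(5 * n - 2) / 3, by omega, 5, by omega⟩
        · exact ⟨(4 * n - 2) / 3, by omega, 4, by omega⟩
      refine ⟨K, hK0, (pow_eq_iff_mul_pow_eq_one hζ).2 ?_⟩
      rwa [e, hδ.pow_eq_one_iff_dvd]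

theorem mem_biUnion_nthRoots_iff {n : ℕ} (hn : 0 < n) {β : k} :
    β ∈ (primitiveRoots n k).biUnion (fun γ => (nthRoots 3 γ).toFinset) ↔
      orderOf (β ^ 3) = n := by
  simp only [Finset.mem_biUnion, mem_primitiveRoots hn, Multiset.mem_toFinset,
    mem_nthRoots (by norm_num : 0 < 3), exists_eq_right']
  rw [IsPrimitiveRoot.iff_orderOf]

theorem card_biUnion_nthRoots [IsAlgClosed k] (h3 : (3 : k) ≠ 0) {n : ℕ} (hn : (n : k) ≠ 0) :
    ((primitiveRoots n k).biUnion fun γ => (nthRoots 3 γ).toFinset).card = 3 * n.totient := by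
  have hn0 : 0 < n := Nat.pos_of_ne_zero fun h => hn (by simp [h])
  obtain ⟨z, hz⟩ := exists_isPrimitiveRoot hn
  rw [Finset.card_biUnion, Finset.sum_const_nat (m := 3), hz.card_primitiveRoots, mul_comm]
  · intro γ hγ
    exact card_nthRoots_toFinset (by exact_mod_cast h3)
      (((mem_primitiveRoots hn0).1 hγ).ne_zero hn0.ne')
  · intro γ _ γ' _ hne
    refine Finset.disjoint_left.2 ?_
    intro β hβ hβ'
    rw [Multiset.mem_toFinset, mem_nthRoots (by norm_num)] at hβ hβ'
    exact hne (hβ.symm.trans hβ')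

theorem card_image_primitiveRoots [IsAlgClosed k] (hζ : ζ ≠ 0) {n : ℕ} (hn : (n : k) ≠ 0) :
    ((primitiveRoots n k).image (ζ ^ 2 * ·)).card = n.totient := by
  obtain ⟨z, hz⟩ := exists_isPrimitiveRoot hn
  rw [Finset.card_image_of_injective _ (mul_right_injective₀ (pow_ne_zero 2 hζ)),
    hz.card_primitiveRoots]

end Roots


/-! ### From ratios to places -/

section Main

variable {q : ℕ} [Fact (IsPrimePow q)] {k : Type*} [Field k] {ζ : k}

theorem hasPOrder_iff (hζ : IsPrimitiveRoot ζ 3) {i : ℕ} (hi : 0 < i) {P : Place k (Y3 q k)} :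
    HasPOrder ζ P i ↔ ∃ α : k, alphaAt P = (α : OnePoint k) ∧ Admissible ζ α ∧
      orderOf (ratio ζ α ^ 3) = i + 1 := by
  unfold HasPOrder
  refine exists_congr fun α => and_congr_right fun _ => and_congr_right fun hα => ?_
  exact pOrder_eq_iff hζ hα hi

theorem hasPOrder_and_hasQOrder_top_iff (hζ : IsPrimitiveRoot ζ 3) {i : ℕ} (hi : 0 < i)
    {P : Place k (Y3 q k)} :
    HasPOrder ζ P i ∧ HasQOrder ζ P ⊤ ↔ ∃ α : k, alphaAt P = (α : OnePoint k) ∧ Admissible ζ α ∧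
      orderOf (ratio ζ α ^ 3) = i + 1 ∧ ¬ ∃ K : ℕ, 0 < K ∧ ratio ζ α ^ (3 * K + 2) = ζ := by
  constructor
  · rintro ⟨⟨α, h, hα, hp⟩, α', h', -, hq⟩
    obtain rfl := OnePoint.coe_injective (h.symm.trans h')
    exact ⟨α, h, hα, (pOrder_eq_iff hζ hα hi).1 hp, (qOrder_eq_top_iff hζ hα).1 hq⟩
  · rintro ⟨α, h, hα, hp, hq⟩
    exact ⟨⟨α, h, hα, (pOrder_eq_iff hζ hα hi).2 hp⟩, α, h, hα, (qOrder_eq_top_iff hζ hα).2 hq⟩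

theorem hasPOrder_and_exists_hasQOrder_iff (hζ : IsPrimitiveRoot ζ 3) {i : ℕ} (hi : 0 < i)
    {P : Place k (Y3 q k)} :
    (HasPOrder ζ P i ∧ ∃ K : ℕ, HasQOrder ζ P K) ↔ ∃ α : k, alphaAt P = (α : OnePoint k) ∧
      Admissible ζ α ∧ orderOf (ratio ζ α ^ 3) = i + 1 ∧
        ∃ K : ℕ, 0 < K ∧ ratio ζ α ^ (3 * K + 2) = ζ := by
  constructor
  · rintro ⟨⟨α, h, hα, hp⟩, K, α', h', -, hq⟩
    obtain rfl := OnePoint.coe_injective (h.symm.trans h')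
    exact ⟨α, h, hα, (pOrder_eq_iff hζ hα hi).1 hp, (exists_qOrder_eq_iff hζ hα).1 ⟨K, hq⟩⟩
  · rintro ⟨α, h, hα, hp, hq⟩
    obtain ⟨K, hK⟩ := (exists_qOrder_eq_iff hζ hα).2 hq
    exact ⟨⟨α, h, hα, (pOrder_eq_iff hζ hα hi).2 hp⟩, K, α, h, hα, hK⟩

theorem encard_places_ratio_mem [IsAlgClosed k] {p e m : ℕ} [Fact p.Prime]
    [CharP k p] (hp : q = p ^ e) (hm : q = 3 * m + 1) (hζ : IsPrimitiveRoot ζ 3) (B : Finset k)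
    (hB : ∀ β ∈ B, β ≠ 0 ∧ β ^ 3 ≠ 1) :
    {P : Place k (Y3 q k) | ∃ α : k, alphaAt P = (α : OnePoint k) ∧ Admissible ζ α ∧
      ratio ζ α ∈ B}.encard = (((q ^ 2 - 1) / 3 * B.card : ℕ) : ℕ∞) := by
  classical
  have hcard : {α | Admissible ζ α ∧ ratio ζ α ∈ B}.encard = B.card := by
    rw [encard_admissible_ratio hζ hB]
    exact Set.encard_coe_eq_coe_finsetCard B
  have hfin : {α | Admissible ζ α ∧ ratio ζ α ∈ B}.Finite :=
    Set.finite_of_encard_eq_coe hcard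
  have hS := hfin.encard_eq_coe_toFinset_card
  rw [hcard, Nat.cast_inj] at hS
  rw [hS, ← encard_places_alphaAt_mem hp hm]
  · congr 1
    ext P
    simp only [Set.mem_ofPred_eq, Set.Finite.mem_toFinset]
    exact exists_congr fun α => and_comm
  · intro α hα
    have hα' := (hfin.mem_toFinset.1 hα).1
    exact ⟨hα'.1, hα'.2.1⟩

theorem exists_charP_of_natCard_eq_sq {F : Type*} [Field F] [Algebra F k]
    (hF : Nat.card F = q ^ 2) :
    ∃ p e : ℕ, p.Prime ∧ CharP k p ∧ q = p ^ e := by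
  obtain ⟨p, e, hp, he, rfl⟩ := (Fact.out : IsPrimePow q)
  have : Finite F := Nat.finite_of_card_ne_zero (by
    rw [hF]; exact pow_ne_zero _ (pow_ne_zero _ hp.ne_zero))
  have := Fintype.ofFinite F
  have h : ((Nat.card F : ℕ) : F) = 0 := by
    rw [Nat.card_eq_fintype_card, Nat.cast_card_eq_zero]
  rw [hF, Nat.cast_pow, Nat.cast_pow] at h
  have h0 : (p : F) = 0 := eq_zero_of_pow_eq_zero (eq_zero_of_pow_eq_zero h)
  refine ⟨p, e, hp.nat_prime, ?_, rfl⟩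
  rw [CharP.charP_iff_prime_eq_zero hp.nat_prime]
  simpa using congrArg (algebraMap F k) h0

/-- The least multiple of `i + 1` that is 2 mod 3 is `2 * (i + 1)` or `i + 1` by residue. For `i =
1` the latter gives the forbidden `K = 0`, and the next one is `8 = 3 * 2 + 2`. -/
theorem isLeast_dvd_eq {i K : ℕ} (hi : 0 < i)
    (h : IsLeast {K : ℕ | 0 < K ∧ i + 1 ∣ 3 * K + 2} K) :
    ((i + 1) % 3 = 1 → K = 2 * i / 3) ∧ ((i + 1) % 3 = 2 → 1 < i → K = (i - 1) / 3) ∧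
      (i = 1 → K = 2) := by
  obtain ⟨⟨hK, c, hc⟩, hmin⟩ := h
  refine ⟨fun h3 => ?_, fun h3 hi1 => ?_, ?_⟩
  · obtain ⟨t, rfl⟩ : ∃ t, i = 3 * t := ⟨i / 3, by omega⟩
    have h1 := hmin (a := 2 * t) ⟨by omega, 2, by ring⟩
    have h2 : c ≠ 1 := by rintro rfl; omega
    have h0 : c ≠ 0 := by rintro rfl; omega
    have h4 : (3 * t + 1) * 2 ≤ (3 * t + 1) * c := Nat.mul_le_mul_left _ (by omega)
    omega
  · obtain ⟨t, rfl⟩ : ∃ t, i = 3 * t + 1 := ⟨i / 3, by omega⟩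
    have h1 := hmin (a := t) ⟨by omega, 1, by ring⟩
    have h4 := Nat.le_of_dvd (by omega) ⟨c, hc⟩
    omega
  · rintro rfl
    have h1 := hmin (a := 2) ⟨by norm_num, 4, by norm_num⟩
    omega

end Main

end MaxCurve

theorem mainTheorem9 (q : ℕ) [Fact (IsPrimePow q)] (hq : q % 3 = 1)
    (F k : Type*) [Field F] (hF : Nat.card F = q ^ 2) [Field k] [Algebra F k] [IsAlgClosure F k]
    (ζ : k) (hζ : IsPrimitiveRoot ζ 3)
    (i : ℕ) (hi : 0 < i) (hcop : Nat.Coprime (i + 1) q) :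
    {P : MaxCurve.Place k (MaxCurve.Y3 q k) | MaxCurve.HasPOrder ζ P i}.encard =
        (((q ^ 2 - 1) * Nat.totient (i + 1) : ℕ) : ℕ∞) ∧
    ((i + 1) % 3 = 0 →
      ∀ P : MaxCurve.Place k (MaxCurve.Y3 q k),
        MaxCurve.HasPOrder ζ P i → MaxCurve.HasQOrder ζ P ⊤) ∧
    ((i + 1) % 3 ≠ 0 →
      {P : MaxCurve.Place k (MaxCurve.Y3 q k) |
          MaxCurve.HasPOrder ζ P i ∧ MaxCurve.HasQOrder ζ P ⊤}.encard =
        ((2 * ((q ^ 2 - 1) / 3) * Nat.totient (i + 1) : ℕ) : ℕ∞) ∧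
      {P : MaxCurve.Place k (MaxCurve.Y3 q k) |
          MaxCurve.HasPOrder ζ P i ∧ ∃ K : ℕ, MaxCurve.HasQOrder ζ P K}.encard =
        (((q ^ 2 - 1) / 3 * Nat.totient (i + 1) : ℕ) : ℕ∞) ∧
      ∀ (P : MaxCurve.Place k (MaxCurve.Y3 q k)) (K : ℕ),
        MaxCurve.HasPOrder ζ P i → MaxCurve.HasQOrder ζ P K →
          ((i + 1) % 3 = 1 → K = 2 * i / 3) ∧
          ((i + 1) % 3 = 2 → 1 < i → K = (i - 1) / 3) ∧
          (i = 1 → K = 2)) := by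
  classical
  have : IsAlgClosed k := IsAlgClosure.isAlgClosed F
  obtain ⟨p, e, hp, hchar, hqp⟩ := MaxCurve.exists_charP_of_natCard_eq_sq (q := q) (k := k) hF
  have : Fact p.Prime := ⟨hp⟩
  obtain ⟨m, hm⟩ : ∃ m, q = 3 * m + 1 := ⟨q / 3, by omega⟩
  have hq1 : 1 < q := (Fact.out : IsPrimePow q).one_lt
  have hN : 3 ∣ q ^ 2 - 1 := by
    rw [← Nat.modEq_iff_dvd' (Nat.one_le_pow _ _ (by omega))]
    exact (Nat.ModEq.pow 2 (show q ≡ 1 [MOD 3] from hq)).symm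
  have hn : ((i + 1 : ℕ) : k) ≠ 0 := by
    rw [Ne, CharP.cast_eq_zero_iff k p]
    intro h
    have he : e ≠ 0 := by rintro rfl; simp at hqp; omega
    exact hp.one_lt.ne' (Nat.dvd_one.1 (hcop ▸ Nat.dvd_gcd h (hqp ▸ dvd_pow_self p he)))
  have h3 := MaxCurve.three_ne_zero_of_isPrimitiveRoot hζ
  have hζ0 : ζ ≠ 0 := hζ.ne_zero (by norm_num)
  set B := (primitiveRoots (i + 1) k).biUnion (fun γ => (nthRoots 3 γ).toFinset)
  have hmemB (β : k) : β ∈ B ↔ orderOf (β ^ 3) = i + 1 :=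
    MaxCurve.mem_biUnion_nthRoots_iff (Nat.succ_pos i)
  have hcardB : B.card = 3 * (i + 1).totient := MaxCurve.card_biUnion_nthRoots h3 hn
  have hB (β : k) (hβ : β ∈ B) : β ≠ 0 ∧ β ^ 3 ≠ 1 := by
    rw [hmemB] at hβ
    refine ⟨?_, fun h => ?_⟩
    · rintro rfl
      simp at hβ
    · rw [h, orderOf_one] at hβ
      omega
  refine ⟨?_, fun hi3 P hP => ?_, fun hi3 => ?_⟩
  · simp only [MaxCurve.hasPOrder_iff hζ hi, ← hmemB]
    rw [MaxCurve.encard_places_ratio_mem hqp hm hζ B hB, hcardB, ← mul_assoc,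
      Nat.div_mul_cancel hN]
  · obtain ⟨α, h, hα, hord⟩ := (MaxCurve.hasPOrder_iff hζ hi).1 hP
    refine ⟨α, h, hα, (MaxCurve.qOrder_eq_top_iff hζ hα).2 ?_⟩
    rintro ⟨K, -, hK⟩
    have hdvd := MaxCurve.dvd_of_pow_eq hζ hK
    rw [hord] at hdvd
    -- Now 3 would divide `3 * K + 2`.
    have := (Nat.dvd_of_mod_eq_zero hi3).trans hdvd
    omega
  · set C := (primitiveRoots (i + 1) k).image (ζ ^ 2 * ·)
    have hmemC (β : k) : (orderOf (β ^ 3) = i + 1 ∧ ∃ K : ℕ, 0 < K ∧ β ^ (3 * K + 2) = ζ) ↔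
        β ∈ C := MaxCurve.orderOf_pow_three_eq_and_exists_iff hζ (Nat.succ_pos i) hi3
    have hcardC : C.card = (i + 1).totient := MaxCurve.card_image_primitiveRoots hζ0 hn
    have hCB : C ⊆ B := fun β hβ => (hmemB β).2 ((hmemC β).2 hβ).1
    have hmemD (β : k) : (orderOf (β ^ 3) = i + 1 ∧ ¬ ∃ K : ℕ, 0 < K ∧ β ^ (3 * K + 2) = ζ) ↔
        β ∈ B \ C := by
      rw [Finset.mem_sdiff, hmemB, ← hmemC]
      exact and_congr_right fun h => by rw [and_iff_right h]
    refine ⟨?_, ?_, fun P K hP hQ => ?_⟩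
    · simp only [MaxCurve.hasPOrder_and_hasQOrder_top_iff hζ hi, hmemD]
      rw [MaxCurve.encard_places_ratio_mem hqp hm hζ _ fun β hβ => hB β (Finset.sdiff_subset hβ),
        Finset.card_sdiff_of_subset hCB, hcardB, hcardC,
        show 3 * (i + 1).totient - (i + 1).totient = 2 * (i + 1).totient by omega]
      congr 1
      ring
    · simp only [MaxCurve.hasPOrder_and_exists_hasQOrder_iff hζ hi, hmemC]
      rw [MaxCurve.encard_places_ratio_mem hqp hm hζ _ fun β hβ => hB β (hCB hβ), hcardC]
    · obtain ⟨α, h, hα, hord⟩ := (MaxCurve.hasPOrder_iff hζ hi).1 hP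
      obtain ⟨α', h', -, hK⟩ := hQ
      obtain rfl := OnePoint.coe_injective (h.symm.trans h')
      have hleast := (MaxCurve.qOrder_eq_iff hζ hα).1 hK
      -- One solution is known, so all the others are detected by divisibility alone.
      simp only [MaxCurve.pow_eq_iff_dvd hζ hleast.1.2, hord] at hleast
      exact MaxCurve.isLeast_dvd_eq hi hleast
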